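/- Let $P$ be a finite poset with least element $\hat 0$ and greatest element $\hat 1$, and suppose that $P$ is graded of rank $n$, i.e. every inclusion-maximal chain of $P$ has length $n$ (has $n+1$ elements). Write $x\lessdot y$ if $y$ covers $x$. An edge-labelling of $P$ assigns an integer $\gamma(x,y)$ to each pair $x\lessdot y$. It is an EL-labelling if for all $y<z$ in $P$ there is a unique unrefinable chain $y=w_0\lessdot w_1\lessdot\cdots\lessdot w_r=z$ with $\gamma(w_0,w_1)\le\gamma(w_1,w_2)\le\cdots\le\gamma(w_{r-1},w_r)$, and the label sequence of this chain, read from bottom to top, lexicographically precedes that of every other unrefinable chain from $y$ to $z$. It is an $S_n$ EL-labelling if moreover the labels along each maximal chain of $P$ are distinct elements of $\{1,\dots,n\}$. Let $x\vee y$ and $x\wedge y$ denote the least upper bound and the greatest lower bound of $x$ and $y$ in $P$, when they exist. For $w,z\ge y$ let $w\wedge_y z$ denote the greatest element of $\{u\in P: y\le u\le w,\ u\le z\}$, when it exists; for $w,y\le z$ let $w\vee^z y$ denote the least element of $\{u\in P: w\le u\le z,\ y\le u\}$, when it exists. An element $x$ is viable if for all $y\le z$ in $P$ both $(x\vee y)\wedge_y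 z$ and $(x\wedge z)\vee^z y$ exist (including the inner join and meet). A viable element $x$ is left modular if $(x\vee y)\wedge_y z=(x\wedge z)\vee^z y$ for all $y\le z$. A maximal chain is viable if all its elements are viable. The poset $P$ is left modular if it has a maximal chain all of whose elements are viable and left modular. For a viable maximal chain $M$ and a chain $c$ of $P$, let $R_M(c)$ be the smallest subposet of $P$ (with the induced order) that contains $M$ and $c$ and that contains $(x\vee y)\wedge_y z$ and $(x\wedge z)\vee^z y$ whenever $x\in M$, $y,z\in R_M(c)$ and $y\le z$. The poset $P$ is supersolvable if it has a viable maximal chain $M$ such that $R_M(c)$ is a distributive lattice for every chain $c$ of $P$. Theorem. The following are equivalent: (1) $P$ has an $S_n$ EL-labelling; (2) $P$ is left modular; (3) $P$ is supersolvable. -/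

import Mathlib

namespace BoundedPoset

section Labellings

variable {P : Type*} [PartialOrder P]

/-- `w` lists, from bottom to top, an unrefinable chain `y = w₀ ⋖ w₁ ⋖ ⋯ ⋖ w_r = z`. -/
def IsUnrefinableChain (y z : P) (w : List P) : Prop :=
  w.IsChain (· ⋖ ·) ∧ w.head? = some y ∧ w.getLast? = some z

/-- The sequence of labels `γ(w₀,w₁), γ(w₁,w₂), …` along `w`. An edge-labelling is given as a
function on all pairs; only its values on covering pairs are ever used. -/
def labelSeq (γ : P → P → ℤ) (w : List P) : List ℤ :=
  List.zipWith γ w w.tail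

/-- The labels along `w` are weakly increasing. -/
def IsIncreasing (γ : P → P → ℤ) (w : List P) : Prop :=
  (labelSeq γ w).IsChain (· ≤ ·)

/-- EL-labelling: every interval `[y, z]` with `y < z` has a unique increasing unrefinable chain,
and its label sequence strictly precedes, in the lexicographic order, that of any other
unrefinable chain from `y` to `z`. The order `<` on `List ℤ` is the lexicographic one. -/
def IsELLabelling (γ : P → P → ℤ) : Prop :=
  ∀ y z : P, y < z →
    (∃! w : List P, IsUnrefinableChain y z w ∧ IsIncreasing γ w) ∧
    ∀ w w' : List P, IsUnrefinableChain y z w → IsIncreasing γ w →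
      IsUnrefinableChain y z w' → w' ≠ w → labelSeq γ w < labelSeq γ w'

/-- All maximal chains have length `n`, that is, `n + 1` elements. -/
def IsGradedOfRank (P : Type*) [PartialOrder P] (n : ℕ) : Prop :=
  ∀ C : Set P, IsMaxChain (· ≤ ·) C → C.ncard = n + 1

/-- `S_n` EL-labelling: an EL-labelling for which the labels along every maximal chain
(an unrefinable chain from `⊥` to `⊤`) are distinct elements of `{1, …, n}`. -/
def IsSnELLabelling [BoundedOrder P] (n : ℕ) (γ : P → P → ℤ) : Prop :=
  IsELLabelling γ ∧
    ∀ w : List P, IsUnrefinableChain ⊥ ⊤ w →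
      (labelSeq γ w).Nodup ∧ ∀ l ∈ labelSeq γ w, l ∈ Set.Icc (1 : ℤ) n

end Labellings

section Modularity

variable {P : Type*} [PartialOrder P]

/-- `a = w ∧_y z`: the greatest common lower bound of `w` and `z` among the elements `≥ y`. -/
def IsMeetAbove (y w z a : P) : Prop :=
  IsGreatest {u : P | y ≤ u ∧ u ≤ w ∧ u ≤ z} a

/-- `b = w ∨^z y`: the least common upper bound of `w` and `y` among the elements `≤ z`. -/
def IsJoinBelow (z w y b : P) : Prop :=
  IsLeast {u : P | u ≤ z ∧ w ≤ u ∧ y ≤ u} b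

/-- `(x ∨ y) ∧_y z` is well-defined and equal to `a`. -/
def IsJoinMeet (x y z a : P) : Prop :=
  ∃ j : P, IsLUB {x, y} j ∧ IsMeetAbove y j z a

/-- `(x ∧ z) ∨^z y` is well-defined and equal to `b`. -/
def IsMeetJoin (x y z b : P) : Prop :=
  ∃ m : P, IsGLB {x, z} m ∧ IsJoinBelow z m y b

/-- `x` is viable. -/
def IsViable (x : P) : Prop :=
  ∀ y z : P, y ≤ z → (∃ a : P, IsJoinMeet x y z a) ∧ ∃ b : P, IsMeetJoin x y z b

/-- `x` is viable and left modular. -/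
def IsLeftModularElement (x : P) : Prop :=
  IsViable x ∧
    ∀ y z : P, y ≤ z → ∀ a b : P, IsJoinMeet x y z a → IsMeetJoin x y z b → a = b

/-- `P` has a maximal chain consisting of viable, left modular elements. -/
def IsLeftModular (P : Type*) [PartialOrder P] : Prop :=
  ∃ M : Set P, IsMaxChain (· ≤ ·) M ∧ ∀ x ∈ M, IsLeftModularElement x

/-- `S` contains `(x ∨ y) ∧_y z` and `(x ∧ z) ∨^z y` for all `x ∈ M` and all `y ≤ z` in `S`. -/
def IsClosedUnder (M S : Set P) : Prop :=
  ∀ x ∈ M, ∀ y ∈ S, ∀ z ∈ S, y ≤ z →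
    (∀ a : P, IsJoinMeet x y z a → a ∈ S) ∧ ∀ b : P, IsMeetJoin x y z b → b ∈ S

/-- `R_M(c)`: the smallest subset of `P` that contains `M` and `c` and is closed as above. -/
def closureWith (M c : Set P) : Set P :=
  ⋂₀ {S : Set P | M ⊆ S ∧ c ⊆ S ∧ IsClosedUnder M S}

/-- The given partial order on `α` is the order of a distributive lattice. -/
def IsDistributiveLattice (α : Type*) [inst : PartialOrder α] : Prop :=
  ∃ L : DistribLattice α, L.toLattice.toPartialOrder = inst

/-- `P` is supersolvable: it has a viable maximal chain `M` such that `R_M(c)`, with the order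
induced from `P`, is a distributive lattice for every chain `c` of `P`. -/
def IsSupersolvable (P : Type*) [PartialOrder P] : Prop :=
  ∃ M : Set P, IsMaxChain (· ≤ ·) M ∧ (∀ x ∈ M, IsViable x) ∧
    ∀ c : Set P, IsChain (· ≤ ·) c → IsDistributiveLattice (closureWith M c)

end Modularity

end BoundedPoset

/-!
The equivalence of `S_n` EL-labellings, left modularity and supersolvability is proved as a cycle:
labelling → supersolvable → left modular → labelling.

**From a labelling.** All labels `1, …, n` occur exactly once on each maximal chain, so the labels
on a chain from `y` to `z` depend on `y` and `z` only, and every `y` has a label set `L y`. The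
increasing chain from `y` to `z` passes through exactly one element `mid i y z` with label set
`L y ∪ (L z ∩ (-∞, i])`, and uniqueness of increasing chains makes it the only such element of
`[y, z]` (`IsSnELLabelling.mid_unique`). For `xᵢ = mid i ⊥ ⊤` this gives at once
`(xᵢ ∨ y) ∧_y z = mid i y z = (xᵢ ∧ z) ∨^z y`: the `xᵢ` form a viable maximal chain `M`, and
`R_M(c)` is the closure of `M ∪ c` under the operations `mid i`. The facts about labels on which
this rests are collected in the structure `LabelSystem`.

**Distributivity.** A chain `c` extends to a maximal chain `C` inside `R_M(c)`, because `R_M(c)`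
contains the increasing chains between consecutive elements of `c`. Call a set `T` of labels
compatible if `b ∈ T`, `a < b` and `a` before `b` on `C` imply `a ∈ T`. Compatible sets are closed
under union and intersection. Each of them is the label set of an element `realize C T` of
`R_M(c)`, obtained by descending along `C` from `⊤` and removing in turn the labels not in `T`
(`LabelSystem.labels_realize`); this assignment is monotone, and by the uniqueness of `mid i y z`
its image is closed under the operations defining `R_M(c)`. Hence `R_M(c)` is isomorphic to a ring
of sets.

**From supersolvability.** The inner joins and meets of `(x ∨ y) ∧_y z` and `(x ∧ z) ∨^z y` are
lattice operations of `R_M({y, z})`, where the modular law identifies the two.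

**From left modularity.** Given a left modular chain `x₀ ⋖ ⋯ ⋖ xₙ`, label `y ⋖ z` by the least `i`
with `z ≤ xᵢ ∨ y`. If `a ≤ u ≤ xᵢ₊₁ ∨ a` but `u ≰ xᵢ ∨ a`, left modularity of `xᵢ₊₁` forces
`xᵢ₊₁ ≤ xᵢ ∨ u` (`LeftModularChain.elt_succ_le_join`). So a label cannot recur on a chain, and
`(xᵢ₊₁ ∨ y) ∧_y z` is equal to or covers `(xᵢ ∨ y) ∧_y z`; the elements `(xᵢ ∨ y) ∧_y z` form the
increasing chain of `[y, z]`. At the first place where another chain leaves it, that chain has the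
larger label (`LeftModularChain.labelSeq_lt`), which gives lexicographic minimality and uniqueness.
-/

namespace BoundedPoset

/-! ### Unrefinable chains as lists -/

section Chains

variable {P : Type*}

theorem labelSeq_cons_cons (γ : P → P → ℤ) (a b : P) (l : List P) :
    labelSeq γ (a :: b :: l) = γ a b :: labelSeq γ (b :: l) := rfl

theorem isIncreasing_iff_pairwise {γ : P → P → ℤ} {w : List P} :
    IsIncreasing γ w ↔ (labelSeq γ w).Pairwise (· ≤ ·) :=
  List.isChain_iff_pairwise

theorem IsIncreasing.tail {γ : P → P → ℤ} {y u : P} {l : List P}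
    (h : IsIncreasing γ (y :: u :: l)) : IsIncreasing γ (u :: l) := by
  rw [isIncreasing_iff_pairwise] at h ⊢
  exact (List.pairwise_cons.1 h).2

variable [PartialOrder P]

theorem not_isUnrefinableChain_nil {y z : P} : ¬ IsUnrefinableChain y z [] := by
  rintro ⟨-, h, -⟩
  simp at h

theorem isUnrefinableChain_singleton {y z a : P} :
    IsUnrefinableChain y z [a] ↔ a = y ∧ a = z := by
  simp [IsUnrefinableChain]

theorem isUnrefinableChain_cons_cons {y z a b : P} {l : List P} :
    IsUnrefinableChain y z (a :: b :: l) ↔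
      a = y ∧ a ⋖ b ∧ IsUnrefinableChain b z (b :: l) := by
  simp only [IsUnrefinableChain, List.isChain_cons_cons, List.head?_cons, Option.some.injEq,
    List.getLast?_cons_cons]
  tauto

theorem isUnrefinableChain_refl (z : P) : IsUnrefinableChain z z [z] :=
  isUnrefinableChain_singleton.2 ⟨rfl, rfl⟩

theorem IsUnrefinableChain.cons {y u z : P} {l : List P} (hyu : y ⋖ u)
    (h : IsUnrefinableChain u z (u :: l)) : IsUnrefinableChain y z (y :: u :: l) :=
  isUnrefinableChain_cons_cons.2 ⟨rfl, hyu, h⟩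

/-- Induction on unrefinable chains with a fixed top, prepending one element at a time. -/
@[elab_as_elim]
theorem IsUnrefinableChain.rec_cons {z : P}
    {motive : ∀ (y : P) (w : List P), IsUnrefinableChain y z w → Prop}
    (singleton : motive z [z] (isUnrefinableChain_refl z))
    (cons : ∀ (y u : P) (l : List P) (hyu : y ⋖ u) (h : IsUnrefinableChain u z (u :: l)),
      motive u (u :: l) h → motive y (y :: u :: l) (h.cons hyu))
    {y : P} {w : List P} (h : IsUnrefinableChain y z w) : motive y w h := by
  induction w generalizing y with
  | nil => exact absurd h not_isUnrefinableChain_nil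
  | cons a l ih =>
    cases l with
    | nil =>
      obtain ⟨rfl, rfl⟩ := isUnrefinableChain_singleton.1 h
      exact singleton
    | cons b l =>
      obtain ⟨rfl, hab, hb⟩ := isUnrefinableChain_cons_cons.1 h
      exact cons a b l hab hb (ih hb)

theorem IsUnrefinableChain.exists_eq_cons {y z : P} {w : List P} (h : IsUnrefinableChain y z w) :
    ∃ l, w = y :: l := by
  cases h using IsUnrefinableChain.rec_cons with
  | singleton => exact ⟨_, rfl⟩
  | cons u l => exact ⟨_, rfl⟩

theorem IsUnrefinableChain.le_of_mem {y z : P} {w : List P} (h : IsUnrefinableChain y z w) :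
    ∀ x ∈ w, y ≤ x ∧ x ≤ z := by
  induction h using IsUnrefinableChain.rec_cons with
  | singleton => simp
  | cons y u l hyu h ih =>
    intro x hx
    rcases List.mem_cons.1 hx with rfl | hx
    · exact ⟨le_rfl, hyu.le.trans (ih u List.mem_cons_self).2⟩
    · exact ⟨hyu.le.trans (ih x hx).1, (ih x hx).2⟩

theorem IsUnrefinableChain.bot_mem {y z : P} {w : List P} (h : IsUnrefinableChain y z w) :
    y ∈ w := by
  obtain ⟨l, rfl⟩ := h.exists_eq_cons
  exact List.mem_cons_self

theorem IsUnrefinableChain.le {y z : P} {w : List P} (h : IsUnrefinableChain y z w) : y ≤ z :=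
  (h.le_of_mem y h.bot_mem).2

theorem IsUnrefinableChain.eq_singleton {y : P} {w : List P} (h : IsUnrefinableChain y y w) :
    w = [y] := by
  obtain ⟨l, rfl⟩ := h.exists_eq_cons
  cases l with
  | nil => rfl
  | cons u l =>
    obtain ⟨-, hyu, hu⟩ := isUnrefinableChain_cons_cons.1 h
    exact absurd (hyu.lt.trans_le hu.le) (lt_irrefl _)

theorem IsUnrefinableChain.eq_of_labelSeq_eq_nil {γ : P → P → ℤ} {y z : P} {w : List P}
    (h : IsUnrefinableChain y z w) (hw : labelSeq γ w = []) : y = z := by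
  cases h using IsUnrefinableChain.rec_cons with
  | singleton => rfl
  | cons u l => simp [labelSeq_cons_cons] at hw

theorem IsUnrefinableChain.length_eq {γ : P → P → ℤ} {y z : P} {w : List P}
    (h : IsUnrefinableChain y z w) : w.length = (labelSeq γ w).length + 1 := by
  induction h using IsUnrefinableChain.rec_cons with
  | singleton => rfl
  | cons y u l hyu h ih => rw [labelSeq_cons_cons, List.length_cons, ih, List.length_cons]

theorem IsUnrefinableChain.nodup {y z : P} {w : List P} (h : IsUnrefinableChain y z w) :
    w.Nodup := by
  induction h using IsUnrefinableChain.rec_cons with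
  | singleton => simp
  | cons y u l hyu h ih =>
    exact List.nodup_cons.2 ⟨fun hy => (hyu.lt.trans_le (h.le_of_mem y hy).1).false, ih⟩

theorem IsUnrefinableChain.total {y z : P} {w : List P} (h : IsUnrefinableChain y z w) :
    ∀ a ∈ w, ∀ b ∈ w, a ≤ b ∨ b ≤ a := by
  induction h using IsUnrefinableChain.rec_cons with
  | singleton => simp
  | cons y u l hyu h ih =>
    have hle := (h.cons hyu).le_of_mem
    intro a ha b hb
    rcases List.mem_cons.1 ha with rfl | ha'
    · exact .inl (hle b hb).1
    · rcases List.mem_cons.1 hb with rfl | hb'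
      · exact .inr (hle a ha).1
      · exact ih a ha' b hb'

/-- An unrefinable chain contains every element of its interval that is comparable to all of its
members. -/
theorem IsUnrefinableChain.mem_of_total {y z x : P} {w : List P} (h : IsUnrefinableChain y z w)
    (hy : y ≤ x) (hz : x ≤ z) (hx : ∀ a ∈ w, a ≤ x ∨ x ≤ a) : x ∈ w := by
  induction h using IsUnrefinableChain.rec_cons with
  | singleton => simp [le_antisymm hz hy]
  | cons y u l hyu h ih =>
    rcases hx u (by simp) with hu | hu
    · exact List.mem_cons_of_mem _ (ih hu fun a ha => hx a (List.mem_cons_of_mem _ ha))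
    · rcases hyu.eq_or_eq hy hu with rfl | rfl <;> simp

theorem IsUnrefinableChain.isMaxChain [BoundedOrder P] {w : List P}
    (h : IsUnrefinableChain (⊥ : P) ⊤ w) : IsMaxChain (· ≤ ·) {x | x ∈ w} := by
  refine ⟨fun a ha b hb _ => h.total a ha b hb, fun t ht hwt => Set.Subset.antisymm hwt ?_⟩
  intro x hx
  exact h.mem_of_total bot_le le_top fun a ha => ht.total (hwt ha) hx

/-- In a poset graded of rank `n`, a maximal chain has `n` labels. -/
theorem IsGradedOfRank.length_labelSeq [BoundedOrder P] {n : ℕ} (hP : IsGradedOfRank P n)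
    (γ : P → P → ℤ) {w : List P} (h : IsUnrefinableChain (⊥ : P) ⊤ w) :
    (labelSeq γ w).length = n := by
  classical
  have h1 := hP _ h.isMaxChain
  have h2 : {x | x ∈ w} = (w.toFinset : Set P) := by ext; simp
  rw [h2, Set.ncard_coe_finset, List.toFinset_card_of_nodup h.nodup,
    h.length_eq (γ := γ)] at h1
  omega

/-- Two unrefinable chains sharing an endpoint can be joined; the shared element is kept once. -/
theorem IsUnrefinableChain.append {γ : P → P → ℤ} {x y z : P} {w t : List P}
    (h : IsUnrefinableChain x y w) (ht : IsUnrefinableChain y z (y :: t)) :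
    IsUnrefinableChain x z (w ++ t) ∧
      labelSeq γ (w ++ t) = labelSeq γ w ++ labelSeq γ (y :: t) := by
  induction h using IsUnrefinableChain.rec_cons with
  | singleton => exact ⟨ht, rfl⟩
  | cons x u l hxu h ih =>
    refine ⟨ih.1.cons hxu, ?_⟩
    have := ih.2
    rw [List.cons_append] at this
    rw [List.cons_append, List.cons_append, labelSeq_cons_cons, labelSeq_cons_cons, this,
      List.cons_append]

theorem exists_isUnrefinableChain [Finite P] {y z : P} (hyz : y ≤ z) :
    ∃ w, IsUnrefinableChain y z w := by
  induction y using WellFoundedGT.induction with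
  | ind y ih =>
    rcases hyz.eq_or_lt with rfl | hlt
    · exact ⟨_, isUnrefinableChain_refl _⟩
    · obtain ⟨u, hyu, huz⟩ := exists_covBy_le_of_lt hlt
      obtain ⟨w, hw⟩ := ih u hyu.lt huz
      obtain ⟨l, rfl⟩ := hw.exists_eq_cons
      exact ⟨_, hw.cons hyu⟩

/-- An increasing unrefinable chain splits at the last label that is at most `i`. -/
theorem IsUnrefinableChain.exists_split {γ : P → P → ℤ} {y z : P} {w : List P}
    (h : IsUnrefinableChain y z w) (hw : IsIncreasing γ w) (i : ℤ) :
    ∃ u w₁ w₂, IsUnrefinableChain y u w₁ ∧ IsUnrefinableChain u z w₂ ∧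
      (∀ l ∈ labelSeq γ w₁, l ≤ i) ∧ ∀ l ∈ labelSeq γ w₂, i < l := by
  induction h using IsUnrefinableChain.rec_cons with
  | singleton =>
    exact ⟨_, _, _, isUnrefinableChain_refl z, isUnrefinableChain_refl z, by simp [labelSeq],
      by simp [labelSeq]⟩
  | cons y v l hyv h ih =>
    rcases le_or_gt (γ y v) i with hi | hi
    · obtain ⟨u, w₁, w₂, h1, h2, h3, h4⟩ := ih hw.tail
      obtain ⟨l₁, rfl⟩ := h1.exists_eq_cons
      refine ⟨u, _, w₂, h1.cons hyv, h2, ?_, h4⟩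
      rw [labelSeq_cons_cons]
      simpa [hi] using h3
    · refine ⟨y, _, _, isUnrefinableChain_refl y, h.cons hyv, by simp [labelSeq], ?_⟩
      rw [isIncreasing_iff_pairwise, labelSeq_cons_cons, List.pairwise_cons] at hw
      rw [labelSeq_cons_cons]
      simp only [List.mem_cons, forall_eq_or_imp]
      exact ⟨hi, fun l hl => hi.trans_le (hw.1 l hl)⟩

/-- A finite chain through `⊥` and `⊤` whose consecutive elements are covering pairs is listed by
an unrefinable chain. -/
theorem exists_list_of_isChain [BoundedOrder P] [Finite P] {C : Set P}
    (hC : IsChain (· ≤ ·) C) (hbot : ⊥ ∈ C) (htop : ⊤ ∈ C)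
    (hcov : ∀ y ∈ C, ∀ u ∈ C, y < u → (∀ v ∈ C, y < v → u ≤ v) → y ⋖ u) :
    ∃ w, IsUnrefinableChain (⊥ : P) ⊤ w ∧ ∀ x, x ∈ w ↔ x ∈ C := by
  have key : ∀ y ∈ C, ∃ w, IsUnrefinableChain y ⊤ w ∧ ∀ x ∈ w, x ∈ C := by
    intro y
    induction y using WellFoundedGT.induction with
    | ind y ih =>
      intro hy
      rcases (le_top : y ≤ ⊤).eq_or_lt with rfl | hlt
      · exact ⟨_, isUnrefinableChain_refl _, by simpa using hy⟩
      · obtain ⟨u, hu⟩ := (Set.toFinite {v | v ∈ C ∧ y < v}).exists_minimal ⟨⊤, htop, hlt⟩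
        have hyu : y ⋖ u := hcov y hy u hu.prop.1 hu.prop.2 fun v hv hyv =>
          (hC.total hu.prop.1 hv).elim id fun hvu => hu.le_of_le ⟨hv, hyv⟩ hvu
        obtain ⟨w, hw, hwC⟩ := ih u hyu.lt hu.prop.1
        obtain ⟨l, rfl⟩ := hw.exists_eq_cons
        refine ⟨_, hw.cons hyu, fun x hx => ?_⟩
        rcases List.mem_cons.1 hx with rfl | hx
        · exact hy
        · exact hwC x hx
  obtain ⟨w, hw, hwC⟩ := key ⊥ hbot
  exact ⟨w, hw, fun x => ⟨hwC x, fun hx =>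
    hw.mem_of_total bot_le le_top fun a ha => hC.total (hwC a ha) hx⟩⟩

theorem _root_.IsMaxChain.mem_of_total {M : Set P} (hM : IsMaxChain (· ≤ ·) M) {x : P}
    (hx : ∀ a ∈ M, a ≤ x ∨ x ≤ a) : x ∈ M := by
  have h : IsChain (· ≤ ·) (insert x M) := hM.1.insert fun b hb _ => (hx b hb).symm
  rw [hM.2 h (Set.subset_insert _ _)]
  exact Set.mem_insert _ _

theorem exists_list_of_isMaxChain [BoundedOrder P] [Finite P] {M : Set P}
    (hM : IsMaxChain (· ≤ ·) M) : ∃ w, IsUnrefinableChain (⊥ : P) ⊤ w ∧ ∀ x, x ∈ w ↔ x ∈ M := by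
  refine exists_list_of_isChain hM.1 (hM.mem_of_total fun a _ => .inr bot_le)
    (hM.mem_of_total fun a _ => .inl le_top) fun y hy u hu hyu h => ⟨hyu, fun v hyv hvu => ?_⟩
  have hv : v ∈ M := hM.mem_of_total fun a ha => by
    rcases hM.1.total hy ha with hya | hay
    · rcases hya.eq_or_lt with rfl | hya
      · exact .inl hyv.le
      · exact .inr (hvu.le.trans (h a ha hya))
    · exact .inl (hay.trans hyv.le)
  exact (hvu.trans_le (h v hv hyv)).false

end Chains

/-! ### Label systems -/

/-- The data which an `S_n` EL-labelling `edge` leaves on a graded bounded poset. `labels y` is the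
set of labels of any unrefinable chain from `⊥` to `y`, and for `y ≤ z` the element `mid i y z` is
the place on the increasing chain from `y` to `z` where the labels pass from `≤ i` to `> i`. -/
structure LabelSystem (P : Type*) [PartialOrder P] [BoundedOrder P] (n : ℕ) where
  labels : P → Set ℤ
  edge : P → P → ℤ
  mid : ℤ → P → P → P
  mono : Monotone labels
  labels_bot : labels ⊥ = ∅
  labels_top : labels ⊤ = Set.Icc 1 (n : ℤ)
  labels_of_covBy : ∀ {y z : P}, y ⋖ z → labels z = insert (edge y z) (labels y)
  le_mid : ∀ i {y z : P}, y ≤ z → y ≤ mid i y z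
  mid_le : ∀ i {y z : P}, y ≤ z → mid i y z ≤ z
  labels_mid : ∀ i {y z : P}, y ≤ z → labels (mid i y z) = labels y ∪ labels z ∩ Set.Iic i
  eq_mid : ∀ i {y u z : P}, y ≤ u → u ≤ z → labels u = labels y ∪ labels z ∩ Set.Iic i →
    u = mid i y z

/-! ### The label system of an `S_n` EL-labelling -/

section FromLabelling

variable {P : Type*} [PartialOrder P] {n : ℕ} {γ : P → P → ℤ}

theorem IsELLabelling.exists_isIncreasing (hγ : IsELLabelling γ) {y z : P} (hyz : y ≤ z) :
    ∃ w, IsUnrefinableChain y z w ∧ IsIncreasing γ w := by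
  rcases hyz.eq_or_lt with rfl | hlt
  · exact ⟨_, isUnrefinableChain_refl y, by simp [IsIncreasing, labelSeq]⟩
  · exact (hγ y z hlt).1.exists

theorem IsELLabelling.eq_of_isIncreasing (hγ : IsELLabelling γ) {y z : P} {w w' : List P}
    (hw : IsUnrefinableChain y z w) (hi : IsIncreasing γ w) (hw' : IsUnrefinableChain y z w')
    (hi' : IsIncreasing γ w') : w = w' := by
  rcases hw.le.eq_or_lt with rfl | hlt
  · rw [hw.eq_singleton, hw'.eq_singleton]
  · exact (hγ y z hlt).1.unique ⟨hw, hi⟩ ⟨hw', hi'⟩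

variable [BoundedOrder P]

/-- The labels occurring on unrefinable chains from `⊥` to `y`. -/
def labelSet (γ : P → P → ℤ) (y : P) : Set ℤ :=
  {l | ∃ w, IsUnrefinableChain ⊥ y w ∧ l ∈ labelSeq γ w}

theorem IsSnELLabelling.mem_labelSeq_iff (hγ : IsSnELLabelling n γ) (hP : IsGradedOfRank P n)
    {w : List P} (h : IsUnrefinableChain ⊥ ⊤ w) (l : ℤ) :
    l ∈ labelSeq γ w ↔ l ∈ Set.Icc (1 : ℤ) n := by
  classical
  obtain ⟨hnd, hmem⟩ := hγ.2 w h
  have hsub : (labelSeq γ w).toFinset ⊆ Finset.Icc (1 : ℤ) n := fun l hl => by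
    simpa using hmem l (List.mem_toFinset.1 hl)
  have heq := Finset.eq_of_subset_of_card_le hsub (by
    rw [List.toFinset_card_of_nodup hnd, hP.length_labelSeq γ h]
    simp)
  rw [← List.mem_toFinset, heq, Finset.mem_Icc, Set.mem_Icc]

/-- The labels of a chain from `y` to `z` are complementary to those of any chain from `⊥` to `y`
followed by one from `z` to `⊤`; so they do not depend on the chain. -/
theorem IsSnELLabelling.mem_labelSeq_iff_of_chains (hγ : IsSnELLabelling n γ)
    (hP : IsGradedOfRank P n) {y z : P} {a w b : List P} (ha : IsUnrefinableChain ⊥ y a)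
    (hw : IsUnrefinableChain y z w) (hb : IsUnrefinableChain z ⊤ b) (l : ℤ) :
    l ∈ labelSeq γ w ↔ l ∈ Set.Icc (1 : ℤ) n ∧ l ∉ labelSeq γ a ∧ l ∉ labelSeq γ b := by
  obtain ⟨b, rfl⟩ := hb.exists_eq_cons
  obtain ⟨h1, e1⟩ := hw.append (γ := γ) hb
  obtain ⟨w, rfl⟩ := hw.exists_eq_cons
  obtain ⟨h2, e2⟩ := ha.append (γ := γ) (t := w ++ b) h1
  have hnd := (hγ.2 _ h2).1
  have hmem := hγ.mem_labelSeq_iff hP h2 l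
  rw [← List.cons_append, e1] at e2
  rw [e2] at hnd hmem
  simp only [List.nodup_append, List.mem_append] at hnd hmem
  rw [← hmem]
  obtain ⟨-, ⟨-, -, h3⟩, h4⟩ := hnd
  constructor
  · intro hl
    exact ⟨.inr (.inl hl), fun h => h4 l h l (.inl hl) rfl, fun h => h3 l hl l h rfl⟩
  · rintro ⟨h | h | h, h5, h6⟩
    · exact absurd h h5
    · exact h
    · exact absurd h h6

variable [Finite P]

theorem IsSnELLabelling.mem_labelSet_iff (hγ : IsSnELLabelling n γ) (hP : IsGradedOfRank P n)
    {y : P} {w : List P} (hw : IsUnrefinableChain ⊥ y w) (l : ℤ) :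
    l ∈ labelSet γ y ↔ l ∈ labelSeq γ w := by
  refine ⟨?_, fun h => ⟨w, hw, h⟩⟩
  rintro ⟨w', hw', hl⟩
  obtain ⟨b, hb⟩ := exists_isUnrefinableChain (le_top : y ≤ ⊤)
  have h0 := isUnrefinableChain_refl (⊥ : P)
  rw [hγ.mem_labelSeq_iff_of_chains hP h0 hw hb]
  rwa [hγ.mem_labelSeq_iff_of_chains hP h0 hw' hb] at hl

theorem IsSnELLabelling.labelSet_eq_union (hγ : IsSnELLabelling n γ) (hP : IsGradedOfRank P n)
    {y z : P} {w : List P} (hw : IsUnrefinableChain y z w) :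
    labelSet γ z = labelSet γ y ∪ {l | l ∈ labelSeq γ w} := by
  obtain ⟨a, ha⟩ := exists_isUnrefinableChain (bot_le : ⊥ ≤ y)
  obtain ⟨t, rfl⟩ := hw.exists_eq_cons
  obtain ⟨h1, h2⟩ := ha.append (γ := γ) hw
  ext l
  rw [hγ.mem_labelSet_iff hP h1, h2, List.mem_append, Set.mem_union,
    hγ.mem_labelSet_iff hP ha, Set.mem_ofPred_eq]

theorem IsSnELLabelling.notMem_labelSet (hγ : IsSnELLabelling n γ) (hP : IsGradedOfRank P n)
    {y z : P} {w : List P} (hw : IsUnrefinableChain y z w) {l : ℤ} (hl : l ∈ labelSeq γ w) :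
    l ∉ labelSet γ y := by
  obtain ⟨a, ha⟩ := exists_isUnrefinableChain (bot_le : ⊥ ≤ y)
  obtain ⟨b, hb⟩ := exists_isUnrefinableChain (le_top : z ≤ ⊤)
  rw [hγ.mem_labelSet_iff hP ha]
  exact ((hγ.mem_labelSeq_iff_of_chains hP ha hw hb l).1 hl).2.1

theorem IsSnELLabelling.labelSet_mono (hγ : IsSnELLabelling n γ) (hP : IsGradedOfRank P n) :
    Monotone (labelSet γ) := by
  intro y z hyz
  obtain ⟨w, hw⟩ := exists_isUnrefinableChain hyz
  rw [hγ.labelSet_eq_union hP hw]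
  exact Set.subset_union_left

theorem IsSnELLabelling.eq_of_labelSet_eq (hγ : IsSnELLabelling n γ) (hP : IsGradedOfRank P n)
    {y z : P} (hyz : y ≤ z) (h : labelSet γ y = labelSet γ z) : y = z := by
  obtain ⟨w, hw⟩ := exists_isUnrefinableChain hyz
  refine hw.eq_of_labelSeq_eq_nil (γ := γ) (List.eq_nil_iff_forall_not_mem.2 fun l hl => ?_)
  refine hγ.notMem_labelSet hP hw hl ?_
  rw [h, hγ.labelSet_eq_union hP hw]
  exact .inr hl

theorem IsSnELLabelling.exists_mid (hγ : IsSnELLabelling n γ) (hP : IsGradedOfRank P n)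
    (i : ℤ) {y z : P} (hyz : y ≤ z) :
    ∃ u, y ≤ u ∧ u ≤ z ∧ labelSet γ u = labelSet γ y ∪ labelSet γ z ∩ Set.Iic i := by
  obtain ⟨w, hw, hinc⟩ := hγ.1.exists_isIncreasing hyz
  obtain ⟨u, w₁, w₂, h1, h2, h3, h4⟩ := hw.exists_split hinc i
  refine ⟨u, h1.le, h2.le, ?_⟩
  rw [hγ.labelSet_eq_union hP h2, hγ.labelSet_eq_union hP h1]
  ext l
  have := h3 l
  have := h4 l
  simp only [Set.mem_union, Set.mem_ofPred_eq, Set.mem_inter_iff, Set.mem_Iic]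
  grind

/-- An element with the labels of `mid i y z` lies on the increasing chain from `y` to `z`. -/
theorem IsSnELLabelling.mem_of_labelSet_eq (hγ : IsSnELLabelling n γ) (hP : IsGradedOfRank P n)
    {i : ℤ} {y u z : P} (hyu : y ≤ u) (huz : u ≤ z)
    (h : labelSet γ u = labelSet γ y ∪ labelSet γ z ∩ Set.Iic i) {w : List P}
    (hw : IsUnrefinableChain y z w) (hinc : IsIncreasing γ w) : u ∈ w := by
  obtain ⟨a, ha, hai⟩ := hγ.1.exists_isIncreasing hyu
  obtain ⟨b, hb, hbi⟩ := hγ.1.exists_isIncreasing huz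
  obtain ⟨b, rfl⟩ := hb.exists_eq_cons
  obtain ⟨h1, h2⟩ := ha.append (γ := γ) hb
  have hab : IsIncreasing γ (a ++ b) := by
    rw [isIncreasing_iff_pairwise] at hai hbi ⊢
    rw [h2, List.pairwise_append]
    refine ⟨hai, hbi, fun l hl l' hl' => le_trans (b := i) ?_ ?_⟩
    · have h3 : l ∈ labelSet γ u := by
        rw [hγ.labelSet_eq_union hP ha]
        exact .inr hl
      rw [h] at h3
      exact (h3.resolve_left (hγ.notMem_labelSet hP ha hl)).2
    · have h3 := hγ.notMem_labelSet hP hb hl'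
      have h4 : l' ∈ labelSet γ z := by
        rw [hγ.labelSet_eq_union hP hb]
        exact .inr hl'
      by_contra hi
      rw [h] at h3
      exact h3 (.inr ⟨h4, (not_le.1 hi).le⟩)
  rw [hγ.1.eq_of_isIncreasing hw hinc h1 hab]
  have := ha.2.2
  exact List.mem_append_left _ (List.mem_of_getLast? this)

theorem IsSnELLabelling.mid_unique (hγ : IsSnELLabelling n γ) (hP : IsGradedOfRank P n)
    {i : ℤ} {y u u' z : P} (hyu : y ≤ u) (huz : u ≤ z)
    (h : labelSet γ u = labelSet γ y ∪ labelSet γ z ∩ Set.Iic i) (hyu' : y ≤ u') (huz' : u' ≤ z)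
    (h' : labelSet γ u' = labelSet γ y ∪ labelSet γ z ∩ Set.Iic i) : u = u' := by
  obtain ⟨w, hw, hinc⟩ := hγ.1.exists_isIncreasing (hyu.trans huz)
  have hu := hγ.mem_of_labelSet_eq hP hyu huz h hw hinc
  have hu' := hγ.mem_of_labelSet_eq hP hyu' huz' h' hw hinc
  rcases hw.total u hu u' hu' with hle | hle
  · exact hγ.eq_of_labelSet_eq hP hle (h.trans h'.symm)
  · exact (hγ.eq_of_labelSet_eq hP hle (h'.trans h.symm)).symm

/-- The label system of an `S_n` EL-labelling. -/
noncomputable def IsSnELLabelling.labelSystem (hγ : IsSnELLabelling n γ)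
    (hP : IsGradedOfRank P n) : LabelSystem P n := by
  classical
  exact
  { labels := labelSet γ
    edge := γ
    mid := fun i y z => if h : y ≤ z then (hγ.exists_mid hP i h).choose else y
    mono := hγ.labelSet_mono hP
    labels_bot := by
      ext l
      rw [hγ.mem_labelSet_iff hP (isUnrefinableChain_refl ⊥)]
      simp [labelSeq]
    labels_top := by
      obtain ⟨w, hw⟩ := exists_isUnrefinableChain (bot_le : (⊥ : P) ≤ ⊤)
      ext l
      rw [hγ.mem_labelSet_iff hP hw, hγ.mem_labelSeq_iff hP hw]
    labels_of_covBy := fun h => by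
      rw [hγ.labelSet_eq_union hP ((isUnrefinableChain_refl _).cons h), Set.insert_eq,
        Set.union_comm]
      congr 1
      ext l
      simp [labelSeq]
    le_mid := fun i y z h => by
      rw [dif_pos h]
      exact (hγ.exists_mid hP i h).choose_spec.1
    mid_le := fun i y z h => by
      rw [dif_pos h]
      exact (hγ.exists_mid hP i h).choose_spec.2.1
    labels_mid := fun i y z h => by
      rw [dif_pos h]
      exact (hγ.exists_mid hP i h).choose_spec.2.2
    eq_mid := fun i y u z hyu huz h => by
      have hyz := hyu.trans huz
      rw [dif_pos hyz]
      obtain ⟨h1, h2, h3⟩ := (hγ.exists_mid hP i hyz).choose_spec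
      exact hγ.mid_unique hP hyu huz h h1 h2 h3 }

end FromLabelling

/-! ### The viable chain of a label system -/

namespace LabelSystem

variable {P : Type*} [PartialOrder P] [BoundedOrder P] {n : ℕ} (S : LabelSystem P n)

theorem eq_of_labels_eq {y z : P} (hyz : y ≤ z) (h : S.labels y = S.labels z) : y = z := by
  have h1 := S.eq_mid 0 le_rfl hyz (by rw [h, Set.union_eq_left.2 Set.inter_subset_left])
  have h2 := S.eq_mid 0 hyz le_rfl (by rw [h, Set.union_eq_left.2 Set.inter_subset_left])
  exact h1.trans h2.symm

theorem le_mid_of_labels_subset {i : ℤ} {y u z : P} (hyu : y ≤ u) (huz : u ≤ z)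
    (h : S.labels u ⊆ S.labels y ∪ Set.Iic i) : u ≤ S.mid i y z := by
  rw [← S.eq_mid i (hyu.trans (S.le_mid i huz)) (S.mid_le i huz)]
  · exact S.le_mid i huz
  · rw [S.labels_mid i huz]
    have h1 := S.mono hyu
    have h2 := S.mono huz
    ext l
    have := @h l
    have := @h1 l
    have := @h2 l
    simp only [Set.mem_union, Set.mem_inter_iff] at *
    tauto

theorem mid_le_of_subset_labels {i : ℤ} {y u z : P} (hyu : y ≤ u) (huz : u ≤ z)
    (h : S.labels z ∩ Set.Iic i ⊆ S.labels u) : S.mid i y z ≤ u := by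
  rw [← S.eq_mid i (S.le_mid i hyu) ((S.mid_le i hyu).trans huz)]
  · exact S.mid_le i hyu
  · rw [S.labels_mid i hyu]
    have h2 := S.mono huz
    ext l
    have := @h l
    have := @h2 l
    simp only [Set.mem_union, Set.mem_inter_iff] at *
    tauto

/-- The maximal chain of the increasing labels `1, 2, …, n`; it is constant outside `[0, n]`. -/
def elt (i : ℤ) : P := S.mid i ⊥ ⊤

theorem labels_elt (i : ℤ) : S.labels (S.elt i) = Set.Icc 1 (n : ℤ) ∩ Set.Iic i := by
  rw [elt, S.labels_mid i bot_le, S.labels_bot, S.labels_top, Set.empty_union]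

theorem eq_elt {u : P} {i : ℤ} (h : S.labels u = Set.Icc 1 (n : ℤ) ∩ Set.Iic i) : u = S.elt i :=
  S.eq_mid i bot_le le_top (by rw [h, S.labels_bot, S.labels_top, Set.empty_union])

theorem elt_mono : Monotone S.elt := by
  intro i j hij
  refine S.le_mid_of_labels_subset bot_le le_top ?_
  rw [S.labels_elt]
  exact fun l hl => .inr (hl.2.trans hij)

theorem elt_zero : S.elt 0 = ⊥ := by
  refine (S.eq_elt ?_).symm
  rw [S.labels_bot]
  ext l
  simp only [Set.mem_empty_iff_false, Set.mem_inter_iff, Set.mem_Icc, Set.mem_Iic, false_iff]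
  omega

theorem elt_natCast : S.elt n = ⊤ := by
  refine (S.eq_elt ?_).symm
  rw [S.labels_top]
  ext l
  simp only [Set.mem_inter_iff, Set.mem_Icc, Set.mem_Iic]
  omega

theorem elt_eq_or_eq {i : ℤ} {x : P} (h1 : S.elt i ≤ x) (h2 : x ≤ S.elt (i + 1)) :
    x = S.elt i ∨ x = S.elt (i + 1) := by
  have h3 := S.mono h1
  have h4 := S.mono h2
  simp only [S.labels_elt] at h3 h4
  by_cases h : i + 1 ∈ S.labels x
  · refine .inr (S.eq_elt (Set.Subset.antisymm h4 fun l hl => ?_))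
    rcases (show l ≤ i + 1 from hl.2).eq_or_lt with rfl | hlt
    · exact h
    · exact h3 ⟨hl.1, Int.lt_add_one_iff.1 hlt⟩
  · refine .inl (S.eq_elt (Set.Subset.antisymm (fun l hl => ⟨(h4 hl).1, ?_⟩) h3))
    have h5 : l ≤ i + 1 := (h4 hl).2
    have h6 : l ≠ i + 1 := fun h6 => h (h6 ▸ hl)
    exact Int.lt_add_one_iff.1 (lt_of_le_of_ne h5 h6)

theorem isMaxChain_range_elt : IsMaxChain (· ≤ ·) (Set.range S.elt) := by
  refine ⟨S.elt_mono.isChain_range, fun t ht hsub => Set.Subset.antisymm hsub fun x hx => ?_⟩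
  have hcmp (i : ℤ) : S.elt i ≤ x ∨ x ≤ S.elt i := ht.total (hsub ⟨i, rfl⟩) hx
  by_contra hne
  have hle (i : ℕ) : S.elt i ≤ x := by
    induction i with
    | zero => simp [S.elt_zero]
    | succ i ih =>
      rw [Nat.cast_succ]
      refine (hcmp _).resolve_right fun h => hne ?_
      rcases S.elt_eq_or_eq ih h with h | h <;> exact ⟨_, h.symm⟩
  exact hne ⟨n, le_antisymm (hle n) (S.elt_natCast ▸ le_top)⟩

theorem isLUB_mid (i : ℤ) (y : P) : IsLUB {S.elt i, y} (S.mid i y ⊤) := by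
  refine ⟨?_, fun w hw => ?_⟩
  · simp only [mem_upperBounds, Set.mem_insert_iff, Set.mem_singleton_iff, forall_eq_or_imp,
      forall_eq]
    refine ⟨S.mid_le_of_subset_labels bot_le le_top ?_, S.le_mid i le_top⟩
    rw [S.labels_mid i le_top]
    exact Set.subset_union_right
  · refine S.mid_le_of_subset_labels (hw (by simp)) le_top ?_
    rw [S.labels_top, ← S.labels_elt]
    exact S.mono (hw (by simp))

theorem isGLB_mid (i : ℤ) (z : P) : IsGLB {S.elt i, z} (S.mid i ⊥ z) := by
  refine ⟨?_, fun w hw => ?_⟩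
  · simp only [mem_lowerBounds, Set.mem_insert_iff, Set.mem_singleton_iff, forall_eq_or_imp,
      forall_eq]
    refine ⟨S.le_mid_of_labels_subset bot_le le_top ?_, S.mid_le i bot_le⟩
    rw [S.labels_mid i bot_le]
    exact Set.union_subset_union_right _ Set.inter_subset_right
  · refine S.le_mid_of_labels_subset bot_le (hw (by simp)) ?_
    have h : S.labels w ⊆ S.labels (S.elt i) := S.mono (hw (by simp))
    rw [S.labels_elt] at h
    exact fun l hl => .inr (h hl).2

theorem isMeetAbove_mid (i : ℤ) {y z : P} (hyz : y ≤ z) :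
    IsMeetAbove y (S.mid i y ⊤) z (S.mid i y z) := by
  refine ⟨⟨S.le_mid i hyz, ?_, S.mid_le i hyz⟩, ?_⟩
  · refine S.le_mid_of_labels_subset (S.le_mid i hyz) le_top ?_
    rw [S.labels_mid i hyz]
    exact Set.union_subset_union_right _ Set.inter_subset_right
  · rintro u ⟨h1, h2, h3⟩
    refine S.le_mid_of_labels_subset h1 h3 ((S.mono h2).trans ?_)
    rw [S.labels_mid i le_top]
    exact Set.union_subset_union_right _ Set.inter_subset_right

theorem isJoinBelow_mid (i : ℤ) {y z : P} (hyz : y ≤ z) :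
    IsJoinBelow z (S.mid i ⊥ z) y (S.mid i y z) := by
  refine ⟨⟨S.mid_le i hyz, ?_, S.le_mid i hyz⟩, ?_⟩
  · refine S.mid_le_of_subset_labels bot_le (S.mid_le i hyz) ?_
    rw [S.labels_mid i hyz]
    exact Set.subset_union_right
  · rintro u ⟨h1, h2, h3⟩
    refine S.mid_le_of_subset_labels h3 h1 (Set.Subset.trans ?_ (S.mono h2))
    rw [S.labels_mid i bot_le]
    exact Set.subset_union_right

theorem isJoinMeet_iff (i : ℤ) {y z a : P} (hyz : y ≤ z) :
    IsJoinMeet (S.elt i) y z a ↔ a = S.mid i y z := by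
  constructor
  · rintro ⟨j, hj, ha⟩
    rw [hj.unique (S.isLUB_mid i y)] at ha
    exact ha.unique (S.isMeetAbove_mid i hyz)
  · rintro rfl
    exact ⟨_, S.isLUB_mid i y, S.isMeetAbove_mid i hyz⟩

theorem isMeetJoin_iff (i : ℤ) {y z b : P} (hyz : y ≤ z) :
    IsMeetJoin (S.elt i) y z b ↔ b = S.mid i y z := by
  constructor
  · rintro ⟨m, hm, hb⟩
    rw [hm.unique (S.isGLB_mid i z)] at hb
    exact hb.unique (S.isJoinBelow_mid i hyz)
  · rintro rfl
    exact ⟨_, S.isGLB_mid i z, S.isJoinBelow_mid i hyz⟩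

theorem isViable_elt (i : ℤ) : IsViable (S.elt i) := fun _ _ hyz =>
  ⟨⟨_, (S.isJoinMeet_iff i hyz).2 rfl⟩, ⟨_, (S.isMeetJoin_iff i hyz).2 rfl⟩⟩

theorem isClosedUnder_iff {R : Set P} : IsClosedUnder (Set.range S.elt) R ↔
    ∀ i, ∀ y ∈ R, ∀ z ∈ R, y ≤ z → S.mid i y z ∈ R := by
  constructor
  · intro h i y hy z hz hyz
    exact (h _ ⟨i, rfl⟩ y hy z hz hyz).1 _ ((S.isJoinMeet_iff i hyz).2 rfl)
  · rintro h _ ⟨i, rfl⟩ y hy z hz hyz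
    refine ⟨fun a ha => ?_, fun b hb => ?_⟩
    · rw [(S.isJoinMeet_iff i hyz).1 ha]
      exact h i y hy z hz hyz
    · rw [(S.isMeetJoin_iff i hyz).1 hb]
      exact h i y hy z hz hyz

end LabelSystem

/-! ### Distributivity of `R_M(c)` -/

/-- A poset which embeds into a power set with image closed under unions and intersections is a
distributive lattice. -/
theorem isDistributiveLattice_of_embedding {α β : Type*} [inst : PartialOrder α] (f : α → Set β)
    (hf : ∀ x y, x ≤ y ↔ f x ⊆ f y) (hunion : ∀ x y, ∃ z, f z = f x ∪ f y)
    (hinter : ∀ x y, ∃ z, f z = f x ∩ f y) : IsDistributiveLattice α := by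
  choose sup hsup using hunion
  choose inf hinf using hinter
  refine ⟨{ inst with
    sup := sup
    inf := inf
    le_sup_left := fun x y => (hf _ _).2 (by rw [hsup]; exact Set.subset_union_left)
    le_sup_right := fun x y => (hf _ _).2 (by rw [hsup]; exact Set.subset_union_right)
    sup_le := fun x y z h1 h2 => (hf _ _).2 (by
      rw [hsup]; exact Set.union_subset ((hf _ _).1 h1) ((hf _ _).1 h2))
    inf_le_left := fun x y => (hf _ _).2 (by rw [hinf]; exact Set.inter_subset_left)
    inf_le_right := fun x y => (hf _ _).2 (by rw [hinf]; exact Set.inter_subset_right)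
    le_inf := fun x y z h1 h2 => (hf _ _).2 (by
      rw [hinf]; exact Set.subset_inter ((hf _ _).1 h1) ((hf _ _).1 h2))
    le_sup_inf := fun x y z => (hf _ _).2 (by
      change f (inf (sup x y) (sup x z)) ⊆ f (sup x (inf y z))
      rw [hinf, hsup, hsup, hsup, hinf, Set.union_inter_distrib_left]) }, rfl⟩

theorem subset_closureWith_left {P : Type*} [PartialOrder P] (M c : Set P) :
    M ⊆ closureWith M c := Set.subset_sInter fun _ h => h.1

theorem subset_closureWith_right {P : Type*} [PartialOrder P] (M c : Set P) :
    c ⊆ closureWith M c := Set.subset_sInter fun _ h => h.2.1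

theorem isClosedUnder_closureWith {P : Type*} [PartialOrder P] (M c : Set P) :
    IsClosedUnder M (closureWith M c) := fun x hx y hy z hz hyz =>
  ⟨fun a ha T hT => (hT.2.2 x hx y (hy T hT) z (hz T hT) hyz).1 a ha,
    fun b hb T hT => (hT.2.2 x hx y (hy T hT) z (hz T hT) hyz).2 b hb⟩

namespace LabelSystem

variable {P : Type*} [PartialOrder P] [BoundedOrder P] {n : ℕ} (S : LabelSystem P n)

/-- If `u` is above `y` and every `mid i y u` is `y` or `u`, then `u` covers `y`: an intermediate
element would split the labels of the interval, and `mid i y u` separates two distinct labels. -/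
theorem covBy_of_mid {y u : P} (hyu : y < u) (h : ∀ i, S.mid i y u = y ∨ S.mid i y u = u) :
    y ⋖ u := by
  refine ⟨hyu, fun v hyv hvu => ?_⟩
  obtain ⟨a, hav, hay⟩ : ∃ a ∈ S.labels v, a ∉ S.labels y := by
    by_contra! hsub
    exact hyv.ne (S.eq_of_labels_eq hyv.le (Set.Subset.antisymm (S.mono hyv.le) hsub))
  obtain ⟨b, hbu, hbv⟩ : ∃ b ∈ S.labels u, b ∉ S.labels v := by
    by_contra! hsub
    exact hvu.ne (S.eq_of_labels_eq hvu.le (Set.Subset.antisymm (S.mono hvu.le) hsub))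
  have hau := S.mono hvu.le hav
  have hby : b ∉ S.labels y := fun hb => hbv (S.mono hyv.le hb)
  have hab : a ≠ b := fun hab => hbv (hab ▸ hav)
  have hmid := S.labels_mid (min a b) hyu.le
  rcases h (min a b) with h | h <;> rw [h] at hmid
  · have h1 : min a b ∈ S.labels y := by
      rw [hmid]
      rcases min_choice a b with h | h <;> rw [h] <;> exact .inr ⟨by assumption, Set.self_mem_Iic⟩
    rcases min_choice a b with h | h <;> rw [h] at h1 <;> contradiction
  · rw [hmid] at hau hbu
    have h1 := (hau.resolve_left hay).2
    have h2 := (hbu.resolve_left hby).2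
    simp only [Set.mem_Iic, le_min_iff, le_refl, true_and, and_true] at h1 h2
    exact hab (le_antisymm h1 h2)

/-- The label sets compatible with a chain `C`: if `b` is in the set and the smaller label `a`
occurs before `b` on `C`, then `a` is in the set. -/
def compatible (C : Set P) : Set (Set ℤ) :=
  {T | T ⊆ S.labels ⊤ ∧
    ∀ u ∈ C, ∀ a ∈ S.labels u, ∀ b ∈ T, b ∉ S.labels u → a < b → a ∈ T}

theorem union_mem_compatible {C : Set P} {T U : Set ℤ} (hT : T ∈ S.compatible C)
    (hU : U ∈ S.compatible C) : T ∪ U ∈ S.compatible C := by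
  refine ⟨Set.union_subset hT.1 hU.1, fun u hu a ha b hb hbu hab => ?_⟩
  exact hb.imp (fun h => hT.2 u hu a ha b h hbu hab) fun h => hU.2 u hu a ha b h hbu hab

theorem inter_mem_compatible {C : Set P} {T U : Set ℤ} (hT : T ∈ S.compatible C)
    (hU : U ∈ S.compatible C) : T ∩ U ∈ S.compatible C := by
  refine ⟨Set.inter_subset_left.trans hT.1, fun u hu a ha b hb hbu hab => ?_⟩
  exact ⟨hT.2 u hu a ha b hb.1 hbu hab, hU.2 u hu a ha b hb.2 hbu hab⟩

theorem labels_elt_mem_compatible (C : Set P) (i : ℤ) :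
    S.labels (S.elt i) ∈ S.compatible C := by
  refine ⟨S.mono le_top, fun u _ a ha b hb _ hab => ?_⟩
  rw [S.labels_elt] at hb ⊢
  have ha' := S.mono le_top ha
  rw [S.labels_top] at ha'
  exact ⟨ha', hab.le.trans hb.2⟩

theorem labels_mem_compatible {C : Set P} (hC : IsChain (· ≤ ·) C) {v : P} (hv : v ∈ C) :
    S.labels v ∈ S.compatible C := by
  refine ⟨S.mono le_top, fun u hu a ha b hb hbu _ => ?_⟩
  rcases hC.total hu hv with h | h
  · exact S.mono h ha
  · exact absurd (S.mono h hb) hbu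

theorem labels_mid_mem_compatible {C : Set P} {y z : P} (hyz : y ≤ z)
    (hy : S.labels y ∈ S.compatible C) (hz : S.labels z ∈ S.compatible C) (i : ℤ) :
    S.labels (S.mid i y z) ∈ S.compatible C := by
  have h : S.labels z ∩ Set.Iic i = S.labels z ∩ S.labels (S.elt i) := by
    rw [S.labels_elt, ← S.labels_top, ← Set.inter_assoc,
      Set.inter_eq_left.2 (S.mono (le_top : z ≤ ⊤))]
  rw [S.labels_mid i hyz, h]
  exact S.union_mem_compatible hy (S.inter_mem_compatible hz (S.labels_elt_mem_compatible C i))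

open Classical in
/-- The element with label set `labels u ∪ T`, where `u` is the first element of an unrefinable
chain ending at `⊤`: descending along the chain, each step of the chain whose label is not in `T`
removes this label. -/
noncomputable def realize : List P → Set ℤ → P
  | [], _ => ⊤
  | [u], _ => u
  | u :: v :: l, T =>
    if S.edge u v ∈ T then realize (v :: l) T else S.mid (S.edge u v - 1) u (realize (v :: l) T)

section Realize

variable {u : P} {w : List P}

theorem le_realize (hw : IsUnrefinableChain u ⊤ w) (T : Set ℤ) : u ≤ S.realize w T := by
  induction hw using IsUnrefinableChain.rec_cons with
  | singleton => rw [realize]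
  | cons u v l huv hv ih =>
    rw [realize]
    split_ifs
    · exact huv.le.trans ih
    · exact S.le_mid _ (huv.le.trans ih)

theorem labels_realize {C : Set P} (hw : IsUnrefinableChain u ⊤ w) (hwC : ∀ x ∈ w, x ∈ C)
    {T : Set ℤ} (hT : T ∈ S.compatible C) : S.labels (S.realize w T) = S.labels u ∪ T := by
  induction hw using IsUnrefinableChain.rec_cons with
  | singleton => rw [realize, Set.union_eq_left.2 hT.1]
  | cons u v l huv hv ih =>
    specialize ih fun x hx => hwC x (List.mem_cons_of_mem _ hx)
    rw [realize]
    split_ifs with h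
    · rw [ih, S.labels_of_covBy huv, Set.insert_union, ← Set.union_insert, Set.insert_eq_of_mem h]
    · rw [S.labels_mid _ (huv.le.trans (S.le_realize hv T)), ih, S.labels_of_covBy huv]
      ext d
      -- A label of `T` that occurs after `edge u v` on the chain is smaller than it.
      have hlt : d ∈ T → d ∉ S.labels u → d < S.edge u v := fun hd hdu => by
        have hne : d ≠ S.edge u v := fun hde => h (hde ▸ hd)
        refine lt_of_le_of_ne (not_lt.1 fun hlt => h ?_) hne
        refine hT.2 v (hwC v (by simp)) _ ?_ d hd ?_ hlt <;> rw [S.labels_of_covBy huv]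
        · exact Set.mem_insert _ _
        · exact fun hmem => hmem.elim hne hdu
      simp only [Set.mem_union, Set.mem_inter_iff, Set.mem_insert_iff, Set.mem_Iic,
        Int.le_sub_one_iff]
      constructor
      · rintro (h1 | ⟨(rfl | h1) | h1, h2⟩)
        · exact .inl h1
        · exact absurd h2 (lt_irrefl _)
        · exact .inl h1
        · exact .inr h1
      · rintro (h1 | h1)
        · exact .inl h1
        · by_cases hdu : d ∈ S.labels u
          · exact .inl hdu
          · exact .inr ⟨.inr h1, hlt h1 hdu⟩

theorem realize_mono (hw : IsUnrefinableChain u ⊤ w) {T U : Set ℤ} (hTU : T ⊆ U) :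
    S.realize w T ≤ S.realize w U := by
  induction hw using IsUnrefinableChain.rec_cons with
  | singleton => rw [realize, realize]
  | cons u v l huv hv ih =>
    have hT := huv.le.trans (S.le_realize hv T)
    have hU := huv.le.trans (S.le_realize hv U)
    rw [realize, realize]
    split_ifs with h1 h2 h2
    · exact ih
    · exact absurd (hTU h1) h2
    · exact (S.mid_le _ hT).trans ih
    · refine S.le_mid_of_labels_subset (S.le_mid _ hT) ((S.mid_le _ hT).trans ih) ?_
      rw [S.labels_mid _ hT]
      exact Set.union_subset_union_right _ Set.inter_subset_right

theorem realize_labels {C : Set P} (hC : IsChain (· ≤ ·) C) (hw : IsUnrefinableChain u ⊤ w)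
    (hwC : ∀ x ∈ w, x ∈ C) : ∀ x ∈ w, S.realize w (S.labels x) = x := by
  have hfirst {u : P} {w : List P} (hw : IsUnrefinableChain u ⊤ w) (hwC : ∀ x ∈ w, x ∈ C) :
      S.realize w (S.labels u) = u := by
    refine (S.eq_of_labels_eq (S.le_realize hw _) ?_).symm
    rw [S.labels_realize hw hwC (S.labels_mem_compatible hC (hwC u hw.bot_mem)), Set.union_self]
  induction hw using IsUnrefinableChain.rec_cons with
  | singleton => simp [realize]
  | cons u v l huv hv ih =>
    intro x hx
    rcases List.mem_cons.1 hx with rfl | hx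
    · exact hfirst (hv.cons huv) hwC
    · have hmem : S.edge u v ∈ S.labels x :=
        S.mono (hv.le_of_mem x hx).1 (by rw [S.labels_of_covBy huv]; exact Set.mem_insert _ _)
      rw [realize, if_pos hmem]
      exact ih (fun x hx => hwC x (List.mem_cons_of_mem _ hx)) x hx

theorem realize_mem {R : Set P} (hR : IsClosedUnder (Set.range S.elt) R)
    (hw : IsUnrefinableChain u ⊤ w) (hwR : ∀ x ∈ w, x ∈ R) (T : Set ℤ) : S.realize w T ∈ R := by
  induction hw using IsUnrefinableChain.rec_cons with
  | singleton => simpa [realize] using hwR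
  | cons u v l huv hv ih =>
    specialize ih fun x hx => hwR x (List.mem_cons_of_mem _ hx)
    rw [realize]
    split_ifs
    · exact ih
    · exact S.isClosedUnder_iff.1 hR _ u (hwR u (by simp)) _ ih
        (huv.le.trans (S.le_realize hv T))

end Realize

/-- Every chain `c` extends to a maximal chain inside `R_M(c)`. -/
theorem exists_list_closureWith [Finite P] {c : Set P} (hc : IsChain (· ≤ ·) c) :
    ∃ w, IsUnrefinableChain (⊥ : P) ⊤ w ∧ (∀ x ∈ c, x ∈ w) ∧
      ∀ x ∈ w, x ∈ closureWith (Set.range S.elt) c := by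
  set R := closureWith (Set.range S.elt) c
  have hR := S.isClosedUnder_iff.1 (isClosedUnder_closureWith (Set.range S.elt) c)
  obtain ⟨C, hcC, hC⟩ := (Set.toFinite {t : Set P | IsChain (· ≤ ·) t ∧ t ⊆ R}).exists_le_maximal
    (show c ∈ {t : Set P | IsChain (· ≤ ·) t ∧ t ⊆ R} from ⟨hc, subset_closureWith_right _ _⟩)
  have hmem {x : P} (hx : x ∈ R) (hcmp : ∀ a ∈ C, a ≤ x ∨ x ≤ a) : x ∈ C :=
    hC.le_of_ge (y := insert x C)
      ⟨hC.prop.1.insert fun b hb _ => (hcmp b hb).symm, Set.insert_subset hx hC.prop.2⟩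
      (Set.subset_insert x C) (Set.mem_insert x C)
  have hM := subset_closureWith_left (Set.range S.elt) c
  have hbot : ⊥ ∈ C := hmem (hM ⟨0, S.elt_zero⟩) fun a _ => .inr bot_le
  have htop : ⊤ ∈ C := hmem (hM ⟨n, S.elt_natCast⟩) fun a _ => .inl le_top
  obtain ⟨w, hw, hwC⟩ := exists_list_of_isChain hC.prop.1 hbot htop fun y hy u hu hyu h => by
    refine S.covBy_of_mid hyu fun i => ?_
    have hle := S.le_mid i hyu.le
    have hge := S.mid_le i hyu.le
    have hmid : S.mid i y u ∈ C := by
      refine hmem (hR i y (hC.prop.2 hy) u (hC.prop.2 hu) hyu.le) fun a ha => ?_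
      rcases hC.prop.1.total hy ha with hya | hay
      · rcases hya.eq_or_lt with rfl | hya
        · exact .inl hle
        · exact .inr (hge.trans (h a ha hya))
      · exact .inl (hay.trans hle)
    rcases hle.eq_or_lt with heq | hlt
    · exact .inl heq.symm
    · exact .inr (le_antisymm hge (h _ hmid hlt))
  exact ⟨w, hw, fun x hx => (hwC x).2 (hcC hx), fun x hx => hC.prop.2 ((hwC x).1 hx)⟩

theorem isDistributiveLattice_closureWith [Finite P] {c : Set P} (hc : IsChain (· ≤ ·) c) :
    IsDistributiveLattice (closureWith (Set.range S.elt) c) := by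
  obtain ⟨w, hw, hcw, hwR⟩ := S.exists_list_closureWith hc
  set R := closureWith (Set.range S.elt) c
  set C := {x | x ∈ w}
  have hC : IsChain (· ≤ ·) C := fun a ha b hb _ => hw.total a ha b hb
  have hwC : ∀ x ∈ w, x ∈ C := fun x hx => hx
  have hlabels {T : Set ℤ} (hT : T ∈ S.compatible C) : S.labels (S.realize w T) = T := by
    rw [S.labels_realize hw hwC hT, S.labels_bot, Set.empty_union]
  -- `realize w` is an isomorphism from the compatible sets onto `R`.
  have himage : ∀ x ∈ R, S.labels x ∈ S.compatible C ∧ S.realize w (S.labels x) = x := by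
    suffices h : R ⊆ {x | S.labels x ∈ S.compatible C ∧ S.realize w (S.labels x) = x} from
      fun x hx => h hx
    refine Set.sInter_subset_of_mem ⟨?_, ?_, ?_⟩
    · rintro _ ⟨i, rfl⟩
      have h := S.labels_elt_mem_compatible C i
      exact ⟨h, S.eq_elt (by rw [hlabels h, S.labels_elt])⟩
    · intro x hx
      exact ⟨S.labels_mem_compatible hC (hcw x hx), S.realize_labels hC hw hwC x (hcw x hx)⟩
    · rw [S.isClosedUnder_iff]
      rintro i y ⟨hy1, hy2⟩ z ⟨hz1, hz2⟩ hyz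
      have h := S.labels_mid_mem_compatible hyz hy1 hz1 i
      refine ⟨h, S.eq_mid i ?_ ?_ (by rw [hlabels h, S.labels_mid i hyz])⟩
      · conv_lhs => rw [← hy2]
        exact S.realize_mono hw (S.mono (S.le_mid i hyz))
      · conv_rhs => rw [← hz2]
        exact S.realize_mono hw (S.mono (S.mid_le i hyz))
  have hreal {T : Set ℤ} (hT : T ∈ S.compatible C) : ∃ z : R, S.labels z = T :=
    ⟨⟨S.realize w T, S.realize_mem (isClosedUnder_closureWith _ _) hw hwR T⟩, hlabels hT⟩
  refine isDistributiveLattice_of_embedding (fun x : R => S.labels x) (fun x y => ?_)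
    (fun x y => ?_) fun x y => ?_
  · refine ⟨fun h => S.mono h, fun h => ?_⟩
    rw [← Subtype.coe_le_coe, ← (himage x x.2).2, ← (himage y y.2).2]
    exact S.realize_mono hw h
  · exact hreal (S.union_mem_compatible (himage x x.2).1 (himage y y.2).1)
  · exact hreal (S.inter_mem_compatible (himage x x.2).1 (himage y y.2).1)

theorem isSupersolvable [Finite P] (S : LabelSystem P n) : IsSupersolvable P := by
  refine ⟨_, S.isMaxChain_range_elt, ?_, fun c hc => S.isDistributiveLattice_closureWith hc⟩
  rintro _ ⟨i, rfl⟩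
  exact S.isViable_elt i

end LabelSystem

/-! ### Left modularity from supersolvability -/

theorem IsDistributiveLattice.eq_of_isJoinMeet_of_isMeetJoin {α : Type*} [inst : PartialOrder α]
    (h : IsDistributiveLattice α) {x y z a b : α} (hyz : y ≤ z) (ha : IsJoinMeet x y z a)
    (hb : IsMeetJoin x y z b) : a = b := by
  obtain ⟨L, rfl⟩ := h
  obtain ⟨j, hj, ha⟩ := ha
  obtain ⟨m, hm, hb⟩ := hb
  obtain rfl : j = x ⊔ y := hj.unique isLUB_pair
  obtain rfl : m = x ⊓ z := hm.unique isGLB_pair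
  have ha' : a = (x ⊔ y) ⊓ z := ha.unique
    ⟨⟨le_inf le_sup_right hyz, inf_le_left, inf_le_right⟩, fun u hu => le_inf hu.2.1 hu.2.2⟩
  have hb' : b = x ⊓ z ⊔ y := hb.unique
    ⟨⟨sup_le inf_le_right hyz, le_sup_left, le_sup_right⟩, fun u hu => sup_le hu.2.1 hu.2.2⟩
  rw [ha', hb', inf_sup_right, inf_eq_left.2 hyz]

/-- The lattice operations of `R_M({y, z})` compute `(x ∨ y) ∧_y z` and `(x ∧ z) ∨^z y`, which
therefore agree by the modular law. -/
theorem IsSupersolvable.isLeftModular {P : Type*} [PartialOrder P] [BoundedOrder P]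
    (h : IsSupersolvable P) : IsLeftModular P := by
  obtain ⟨M, hM, hviable, hdistrib⟩ := h
  refine ⟨M, hM, fun x hx => ⟨hviable x hx, fun y z hyz a b ha hb => ?_⟩⟩
  have hbotM : ⊥ ∈ M := hM.mem_of_total fun a _ => .inr bot_le
  have htopM : ⊤ ∈ M := hM.mem_of_total fun a _ => .inl le_top
  have hMR := subset_closureWith_left M {y, z}
  have hcR := subset_closureWith_right M {y, z}
  have hcl := isClosedUnder_closureWith M {y, z} x hx
  have hyR := hcR (show y ∈ ({y, z} : Set P) by simp)
  have hzR := hcR (show z ∈ ({y, z} : Set P) by simp)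
  have haR := (hcl y hyR z hzR hyz).1 a ha
  have hbR := (hcl y hyR z hzR hyz).2 b hb
  obtain ⟨j, hj, ha1, ha2⟩ := ha
  obtain ⟨m, hm, hb1, hb2⟩ := hb
  have hjy : y ≤ j := hj.1 (by simp)
  have hmz : m ≤ z := hm.1 (by simp)
  -- The join `j = (x ∨ y) ∧_y ⊤` and the meet `m = (x ∧ z) ∨^z ⊥` belong to `R_M({y, z})`.
  have hjR : j ∈ closureWith M {y, z} := (hcl y hyR ⊤ (hMR htopM) le_top).1 j
    ⟨j, hj, ⟨hjy, le_rfl, le_top⟩, fun u hu => hu.2.1⟩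
  have hmR : m ∈ closureWith M {y, z} := (hcl ⊥ (hMR hbotM) z hzR bot_le).2 m
    ⟨m, hm, ⟨hmz, le_rfl, bot_le⟩, fun u hu => hu.2.1⟩
  have ha' : IsJoinMeet (⟨x, hMR hx⟩ : closureWith M {y, z}) ⟨y, hyR⟩ ⟨z, hzR⟩ ⟨a, haR⟩ := by
    refine ⟨⟨j, hjR⟩, ⟨?_, fun w hw => ?_⟩, ha1, fun u hu => ha2 hu⟩
    · have hjx : x ≤ j := hj.1 (by simp)
      simp [hjx, hjy]
    · have h1 : x ≤ (w : P) := hw (Set.mem_insert _ _)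
      have h2 : y ≤ (w : P) := hw (Set.mem_insert_of_mem _ rfl)
      exact hj.2 (by simp [h1, h2])
  have hb' : IsMeetJoin (⟨x, hMR hx⟩ : closureWith M {y, z}) ⟨y, hyR⟩ ⟨z, hzR⟩ ⟨b, hbR⟩ := by
    refine ⟨⟨m, hmR⟩, ⟨?_, fun w hw => ?_⟩, hb1, fun u hu => hb2 hu⟩
    · have hmx : m ≤ x := hm.1 (by simp)
      simp [hmx, hmz]
    · have h1 : (w : P) ≤ x := hw (Set.mem_insert _ _)
      have h2 : (w : P) ≤ z := hw (Set.mem_insert_of_mem _ rfl)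
      exact hm.2 (by simp [h1, h2])
  exact congrArg Subtype.val
    ((hdistrib {y, z} (IsChain.pair hyz)).eq_of_isJoinMeet_of_isMeetJoin hyz ha' hb')

/-! ### The labelling of a left modular chain -/

/-- A maximal chain of viable left modular elements, indexed with possible repetitions, together
with the operations it provides: `mid i y z` is the common value of `(xᵢ ∨ y) ∧_y z` and
`(xᵢ ∧ z) ∨^z y`, where `xᵢ = elt i`. -/
structure LeftModularChain (P : Type*) [PartialOrder P] [BoundedOrder P] (n : ℕ) where
  elt : ℕ → P
  join : ℕ → P → P
  meet : ℕ → P → P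
  mid : ℕ → P → P → P
  elt_zero : elt 0 = ⊥
  elt_top : elt n = ⊤
  wcovBy : ∀ i, elt i ⩿ elt (i + 1)
  isLUB_join : ∀ i y, IsLUB {elt i, y} (join i y)
  isGLB_meet : ∀ i z, IsGLB {elt i, z} (meet i z)
  isMeetAbove_mid : ∀ i {y z : P}, y ≤ z → IsMeetAbove y (join i y) z (mid i y z)
  isJoinBelow_mid : ∀ i {y z : P}, y ≤ z → IsJoinBelow z (meet i z) y (mid i y z)

namespace LeftModularChain

variable {P : Type*} [PartialOrder P] [BoundedOrder P] {n : ℕ} (X : LeftModularChain P n)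

theorem elt_le_join (i : ℕ) (y : P) : X.elt i ≤ X.join i y := (X.isLUB_join i y).1 (by simp)

theorem le_join (i : ℕ) (y : P) : y ≤ X.join i y := (X.isLUB_join i y).1 (by simp)

theorem join_le {i : ℕ} {y w : P} (h1 : X.elt i ≤ w) (h2 : y ≤ w) : X.join i y ≤ w :=
  (X.isLUB_join i y).2 (by simp [h1, h2])

theorem meet_le_elt (i : ℕ) (z : P) : X.meet i z ≤ X.elt i := (X.isGLB_meet i z).1 (by simp)

theorem meet_le (i : ℕ) (z : P) : X.meet i z ≤ z := (X.isGLB_meet i z).1 (by simp)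

theorem le_meet {i : ℕ} {z w : P} (h1 : w ≤ X.elt i) (h2 : w ≤ z) : w ≤ X.meet i z :=
  (X.isGLB_meet i z).2 (by simp [h1, h2])

theorem elt_mono : Monotone X.elt := monotone_nat_of_le_succ fun i => (X.wcovBy i).le

theorem join_mono {i j : ℕ} (hij : i ≤ j) {y z : P} (h : y ≤ z) : X.join i y ≤ X.join j z :=
  X.join_le ((X.elt_mono hij).trans (X.elt_le_join j z)) (h.trans (X.le_join j z))

theorem le_mid {i : ℕ} {y u z : P} (hyu : y ≤ u) (huz : u ≤ z) (h : u ≤ X.join i y) :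
    u ≤ X.mid i y z :=
  (X.isMeetAbove_mid i (hyu.trans huz)).2 ⟨hyu, h, huz⟩

theorem mid_le {i : ℕ} {y u z : P} (hyu : y ≤ u) (huz : u ≤ z) (h : X.meet i z ≤ u) :
    X.mid i y z ≤ u :=
  (X.isJoinBelow_mid i (hyu.trans huz)).2 ⟨huz, h, hyu⟩

/-- If `xᵢ ∧ z ≤ y` then no element of `(y, z]` lies below `xᵢ ∨ y`. -/
theorem eq_of_le_join {i : ℕ} {y u z : P} (hyu : y ≤ u) (huz : u ≤ z) (hm : X.meet i z ≤ y)
    (h : u ≤ X.join i y) : u = y :=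
  le_antisymm ((X.le_mid hyu huz h).trans (X.mid_le le_rfl (hyu.trans huz) hm)) hyu

/-- The exchange property behind the whole labelling: if `u` enters below `x ∨ a` exactly when `x`
moves from `xᵢ` to `xᵢ₊₁`, then `xᵢ₊₁ ≤ xᵢ ∨ u`. -/
theorem elt_succ_le_join {i : ℕ} {a u : P} (hau : a ≤ u) (h1 : u ≤ X.join (i + 1) a)
    (h2 : ¬ u ≤ X.join i a) : X.elt (i + 1) ≤ X.join i u := by
  -- `xᵢ₊₁ ∧ (xᵢ ∨ u)` is one of `xᵢ`, `xᵢ₊₁`, and left modularity of `xᵢ₊₁` excludes the former.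
  rcases (X.wcovBy i).eq_or_eq (X.le_meet (X.wcovBy i).le (X.elt_le_join i u))
      (X.meet_le_elt (i + 1) (X.join i u)) with h | h
  · refine absurd ?_ h2
    have hle : u ≤ X.mid (i + 1) a (X.join i u) := X.le_mid hau (X.le_join i u) h1
    exact hle.trans (X.mid_le (X.le_join i a) (X.join_mono le_rfl hau) (h.le.trans
      (X.elt_le_join i a)))
  · rw [← h]
    exact X.meet_le _ _

/-- If `xᵢ ∧ z ≤ y` then `(xᵢ₊₁ ∨ y) ∧_y z` covers `y` or equals it. -/
theorem eq_of_lt_of_le {i : ℕ} {y u v z : P} (hm : X.meet i z ≤ y) (hyu : y < u) (huv : u ≤ v)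
    (hvz : v ≤ z) (hv : v ≤ X.join (i + 1) y) : v = u := by
  have hx := X.elt_succ_le_join hyu.le (huv.trans hv) fun h =>
    hyu.ne' (X.eq_of_le_join hyu.le (huv.trans hvz) hm h)
  refine X.eq_of_le_join huv hvz (hm.trans hyu.le) (hv.trans ?_)
  exact X.join_le hx (hyu.le.trans (X.le_join i u))

/-- The least `i` with `z ≤ xᵢ ∨ y`. -/
noncomputable def index (y z : P) : ℕ := sInf {i | z ≤ X.join i y}

theorem join_top (y : P) : X.join n y = ⊤ :=
  top_le_iff.1 (X.elt_top ▸ X.elt_le_join n y)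

theorem le_join_index (y z : P) : z ≤ X.join (X.index y z) y :=
  Nat.sInf_mem (s := {i | z ≤ X.join i y}) ⟨n, by simp [X.join_top]⟩

theorem index_le {i : ℕ} {y z : P} (h : z ≤ X.join i y) : X.index y z ≤ i := Nat.sInf_le h

theorem index_le_rank (y z : P) : X.index y z ≤ n := X.index_le (by simp [X.join_top])

theorem index_pos {y z : P} (h : y < z) : 0 < X.index y z := by
  by_contra h0
  have h1 := X.le_join_index y z
  rw [Nat.eq_zero_of_not_pos h0] at h1
  exact (h.trans_le (h1.trans (X.join_le (by simp [X.elt_zero]) le_rfl))).false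

theorem meet_le_of_lt_index {i : ℕ} {y z : P} (h : y ⋖ z) (hi : i < X.index y z) :
    X.meet i z ≤ y := by
  obtain ⟨⟨h1, h2, h3⟩, -⟩ := X.isMeetAbove_mid i h.le
  rcases h.eq_or_eq h1 h3 with h4 | h4
  · exact h4 ▸ (X.isJoinBelow_mid i h.le).1.2.1
  · exact absurd (X.index_le (h4 ▸ h2)) (not_le.2 hi)

/-- The edge-labelling defined by a left modular chain. -/
noncomputable def labelling (y z : P) : ℤ := X.index y z

theorem lt_labelling_of_meet_le {i : ℕ} {y z : P} {w : List P} (hw : IsUnrefinableChain y z w)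
    (h : X.meet i z ≤ y) : ∀ l ∈ labelSeq X.labelling w, (i : ℤ) < l := by
  induction hw using IsUnrefinableChain.rec_cons with
  | singleton => simp [labelSeq]
  | cons y u l hyu hu ih =>
    rw [labelSeq_cons_cons]
    simp only [List.mem_cons, forall_eq_or_imp]
    refine ⟨?_, ih (h.trans hyu.le)⟩
    rw [labelling, Nat.cast_lt]
    by_contra hi
    refine hyu.lt.ne' (X.eq_of_le_join hyu.le hu.le h ?_)
    exact (X.le_join_index y u).trans (X.join_mono (not_lt.1 hi) le_rfl)

theorem meet_le_of_lt_labelling {i : ℕ} {y z : P} {w : List P} (hw : IsUnrefinableChain y z w)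
    (h : ∀ l ∈ labelSeq X.labelling w, (i : ℤ) < l) : X.meet i z ≤ y := by
  induction hw using IsUnrefinableChain.rec_cons with
  | singleton => exact X.meet_le i _
  | cons y u l hyu hu ih =>
    rw [labelSeq_cons_cons] at h
    simp only [List.mem_cons, forall_eq_or_imp, labelling, Nat.cast_lt] at h
    exact (X.le_meet (X.meet_le_elt i _) (ih h.2)).trans (X.meet_le_of_lt_index hyu h.1)

theorem exists_isIncreasing [Finite P] {y z : P} (hyz : y ≤ z) :
    ∃ w, IsUnrefinableChain y z w ∧ IsIncreasing X.labelling w := by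
  classical
  induction y using WellFoundedGT.induction with
  | ind y ih =>
    rcases hyz.eq_or_lt with rfl | hlt
    · exact ⟨_, isUnrefinableChain_refl y, by simp [IsIncreasing, labelSeq]⟩
    -- The first step goes to `mid (i + 1) y z`, where `i + 1` is least with `xᵢ₊₁ ∧ z ≰ y`.
    have hex : ∃ i, ¬ X.meet i z ≤ y := ⟨n, fun h =>
      (hlt.trans_le ((X.le_meet (X.elt_top ▸ le_top) le_rfl).trans h)).false⟩
    obtain ⟨i, hi⟩ : ∃ i, Nat.find hex = i + 1 := by
      refine Nat.exists_eq_succ_of_ne_zero fun h0 => Nat.find_spec hex ?_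
      rw [h0]
      exact (X.meet_le_elt 0 z).trans (X.elt_zero ▸ bot_le)
    have hm : X.meet i z ≤ y := not_not.1 (Nat.find_min hex (hi ▸ Nat.lt_succ_self i))
    have hm' : ¬ X.meet (i + 1) z ≤ y := hi ▸ Nat.find_spec hex
    obtain ⟨⟨h1, h2, h3⟩, -⟩ := X.isMeetAbove_mid (i + 1) hyz
    have h4 := (X.isJoinBelow_mid (i + 1) hyz).1.2.1
    have hyu : y < X.mid (i + 1) y z := lt_of_le_of_ne h1 fun h => hm' (h ▸ h4)
    have hcov : y ⋖ X.mid (i + 1) y z :=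
      ⟨hyu, fun v hyv hv => hv.ne' (X.eq_of_lt_of_le hm hyv hv.le h3 h2)⟩
    obtain ⟨w, hw, hinc⟩ := ih _ hyu h3
    obtain ⟨l, rfl⟩ := hw.exists_eq_cons
    refine ⟨_, hw.cons hcov, ?_⟩
    rw [isIncreasing_iff_pairwise] at hinc ⊢
    rw [labelSeq_cons_cons, List.pairwise_cons]
    refine ⟨fun b hb => ?_, hinc⟩
    have h5 : (X.index y (X.mid (i + 1) y z) : ℤ) ≤ i + 1 := by exact_mod_cast X.index_le h2
    have h6 := X.lt_labelling_of_meet_le hw (hm.trans h1) b hb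
    rw [labelling]
    omega

/-- An increasing chain lexicographically precedes all others. -/
theorem labelSeq_lt {y z : P} {w w' : List P} (hw : IsUnrefinableChain y z w)
    (hinc : IsIncreasing X.labelling w) (hw' : IsUnrefinableChain y z w') (hne : w' ≠ w) :
    labelSeq X.labelling w < labelSeq X.labelling w' := by
  induction hw using IsUnrefinableChain.rec_cons generalizing w' with
  | singleton => exact absurd hw'.eq_singleton hne
  | cons y u l hyu hu ih =>
    obtain ⟨l', rfl⟩ := hw'.exists_eq_cons
    cases l' with
    | nil =>
      obtain ⟨-, rfl⟩ := isUnrefinableChain_singleton.1 hw'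
      exact absurd (hyu.lt.trans_le hu.le) (lt_irrefl _)
    | cons u' l' =>
      obtain ⟨-, hyu', hu'⟩ := isUnrefinableChain_cons_cons.1 hw'
      obtain ⟨i, hi⟩ := Nat.exists_eq_add_one_of_ne_zero (X.index_pos hyu.lt).ne'
      have hm : X.meet i z ≤ y := by
        refine X.meet_le_of_lt_labelling (hu.cons hyu) ?_
        have h := isIncreasing_iff_pairwise.1 hinc
        rw [labelSeq_cons_cons, List.pairwise_cons] at h
        have h0 : (i : ℤ) < X.labelling y u := by
          rw [labelling, hi]
          simp
        rw [labelSeq_cons_cons]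
        simp only [List.mem_cons, forall_eq_or_imp]
        exact ⟨h0, fun b hb => h0.trans_le (h.1 b hb)⟩
      have hlabel := X.lt_labelling_of_meet_le hw' hm (X.labelling y u')
        (by simp [labelSeq_cons_cons])
      rw [labelling, Nat.cast_lt] at hlabel
      rw [labelSeq_cons_cons, labelSeq_cons_cons]
      rcases (Nat.add_one_le_of_lt hlabel).eq_or_lt with heq | hlt
      · -- Both first steps stay below `mid (i + 1) y z`, which covers `y`.
        have h1 : u ≤ X.join (i + 1) y := hi ▸ X.le_join_index y u
        have h2 : u' ≤ X.join (i + 1) y := heq ▸ X.le_join_index y u'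
        have h3 := X.eq_of_lt_of_le hm hyu.lt (X.le_mid hyu.le hu.le h1)
          (X.isMeetAbove_mid (i + 1) (hyu.le.trans hu.le)).1.2.2
          (X.isMeetAbove_mid (i + 1) (hyu.le.trans hu.le)).1.2.1
        have h4 := X.eq_of_lt_of_le hm hyu'.lt (X.le_mid hyu'.le hu'.le h2)
          (X.isMeetAbove_mid (i + 1) (hyu.le.trans hu.le)).1.2.2
          (X.isMeetAbove_mid (i + 1) (hyu.le.trans hu.le)).1.2.1
        obtain rfl : u = u' := h3.symm.trans h4
        exact List.cons_lt_cons_self.2 (ih hinc.tail hu' fun h => hne (by rw [h]))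
      · refine List.cons_lt_cons_iff.2 (.inl ?_)
        rw [labelling, labelling, hi, Nat.cast_lt]
        exact hlt

theorem nodup_labelSeq {y z : P} {w : List P} (hw : IsUnrefinableChain y z w) :
    (labelSeq X.labelling w).Nodup := by
  induction hw using IsUnrefinableChain.rec_cons with
  | singleton => simp [labelSeq]
  | cons y u l hyu hu ih =>
    rw [labelSeq_cons_cons, List.nodup_cons]
    refine ⟨fun hmem => ?_, ih⟩
    obtain ⟨i, hi⟩ := Nat.exists_eq_add_one_of_ne_zero (X.index_pos hyu.lt).ne'
    have hx : X.elt (i + 1) ≤ X.join i u := X.elt_succ_le_join hyu.le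
      (hi ▸ X.le_join_index y u) fun h => by have := X.index_le h; omega
    -- From `u` on, `xᵢ` and `xᵢ₊₁` have the same joins, so the label `i + 1` cannot recur.
    have key : ∀ {a : P} {t : List P}, IsUnrefinableChain a z t → u ≤ a →
        X.labelling y u ∉ labelSeq X.labelling t := by
      intro a t ht
      induction ht using IsUnrefinableChain.rec_cons with
      | singleton => simp [labelSeq]
      | cons a b t hab hb ih =>
        intro hua hmem
        rw [labelSeq_cons_cons, List.mem_cons] at hmem
        rcases hmem with h | h
        · rw [labelling, labelling, Nat.cast_inj] at h
          have h1 : b ≤ X.join (i + 1) a := by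
            rw [← hi, h]
            exact X.le_join_index a b
          have h2 : b ≤ X.join i a :=
            h1.trans (X.join_le (hx.trans (X.join_mono le_rfl hua)) (X.le_join i a))
          have := X.index_le h2
          omega
        · exact ih (hua.trans hab.le) h
    exact key hu le_rfl hmem

theorem labelling_mem_Icc {y z : P} {w : List P} (hw : IsUnrefinableChain y z w) :
    ∀ l ∈ labelSeq X.labelling w, l ∈ Set.Icc (1 : ℤ) n := by
  induction hw using IsUnrefinableChain.rec_cons with
  | singleton => simp [labelSeq]
  | cons y u l hyu hu ih =>
    rw [labelSeq_cons_cons]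
    simp only [List.mem_cons, forall_eq_or_imp]
    refine ⟨?_, ih⟩
    have h1 := X.index_pos hyu.lt
    have h2 := X.index_le_rank y u
    rw [labelling, Set.mem_Icc]
    omega

theorem isSnELLabelling [Finite P] : IsSnELLabelling n X.labelling := by
  refine ⟨fun y z hyz => ⟨?_, fun w w' hw hi hw' hne => X.labelSeq_lt hw hi hw' hne⟩,
    fun w hw => ⟨X.nodup_labelSeq hw, X.labelling_mem_Icc hw⟩⟩
  obtain ⟨w, hw, hinc⟩ := X.exists_isIncreasing hyz.le
  refine ⟨w, ⟨hw, hinc⟩, fun w' ⟨hw', hinc'⟩ => ?_⟩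
  by_contra hne
  exact lt_asymm (X.labelSeq_lt hw hinc hw' hne) (X.labelSeq_lt hw' hinc' hw (Ne.symm hne))

end LeftModularChain

theorem IsLeftModularElement.exists_operations {P : Type*} [PartialOrder P] [BoundedOrder P]
    {x : P} (hx : IsLeftModularElement x) :
    ∃ (join meet : P → P) (mid : P → P → P), (∀ y, IsLUB {x, y} (join y)) ∧
      (∀ z, IsGLB {x, z} (meet z)) ∧
      ∀ y z, y ≤ z → IsMeetAbove y (join y) z (mid y z) ∧ IsJoinBelow z (meet z) y (mid y z) := by
  have hj (y : P) : ∃ j, IsLUB {x, y} j := by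
    obtain ⟨⟨a, j, hj, -⟩, -⟩ := hx.1 y y le_rfl
    exact ⟨j, hj⟩
  have hm (z : P) : ∃ m, IsGLB {x, z} m := by
    obtain ⟨-, b, m, hm, -⟩ := hx.1 z z le_rfl
    exact ⟨m, hm⟩
  choose join hjoin using hj
  choose meet hmeet using hm
  have hf (y z : P) : ∃ f, y ≤ z →
      IsMeetAbove y (join y) z f ∧ IsJoinBelow z (meet z) y f := by
    by_cases hyz : y ≤ z
    · obtain ⟨⟨a, ha⟩, ⟨b, hb⟩⟩ := hx.1 y z hyz
      obtain rfl := hx.2 y z hyz a b ha hb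
      obtain ⟨j, hj, ha⟩ := ha
      obtain ⟨m, hm, hb⟩ := hb
      rw [hj.unique (hjoin y)] at ha
      rw [hm.unique (hmeet z)] at hb
      exact ⟨a, fun _ => ⟨ha, hb⟩⟩
    · exact ⟨y, fun h => absurd h hyz⟩
  choose mid hmid using hf
  exact ⟨join, meet, mid, hjoin, hmeet, hmid⟩

/-- Position `i` of an unrefinable chain from `y` to `⊤`, extended by `⊤` beyond its end. -/
theorem IsUnrefinableChain.getD_wcovBy {P : Type*} [PartialOrder P] [OrderTop P] {y : P}
    {w : List P} (hw : IsUnrefinableChain y ⊤ w) (i : ℕ) : w.getD i ⊤ ⩿ w.getD (i + 1) ⊤ := by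
  induction hw using IsUnrefinableChain.rec_cons generalizing i with
  | singleton => cases i <;> simp
  | cons y u l hyu hu ih =>
    cases i with
    | zero => simpa using hyu.wcovBy
    | succ i => simpa using ih i

theorem IsLeftModular.nonempty_leftModularChain {P : Type*} [PartialOrder P] [BoundedOrder P]
    [Finite P] {n : ℕ} (hP : IsGradedOfRank P n) (h : IsLeftModular P) :
    Nonempty (LeftModularChain P n) := by
  obtain ⟨M, hM, hmod⟩ := h
  obtain ⟨w, hw, hwM⟩ := exists_list_of_isMaxChain hM
  have hlen : w.length = n + 1 := by
    rw [hw.length_eq (γ := fun _ _ => 0), hP.length_labelSeq _ hw]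
  have hlast : w.getD n ⊤ = ⊤ := by
    have h1 := hw.2.2
    rw [List.getLast?_eq_getElem?, hlen, Nat.add_sub_cancel] at h1
    rw [List.getD_eq_getElem?_getD, h1, Option.getD_some]
  have hmem (i : ℕ) : IsLeftModularElement (w.getD i ⊤) := by
    refine hmod _ ((hwM _).1 ?_)
    rw [List.getD_eq_getElem?_getD]
    rcases lt_or_ge i w.length with hi | hi
    · rw [List.getElem?_eq_getElem hi, Option.getD_some]
      exact List.getElem_mem hi
    · rw [List.getElem?_eq_none hi, Option.getD_none]
      exact List.mem_of_getLast? hw.2.2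
  choose join meet mid hjoin hmeet hmid using fun i => (hmem i).exists_operations
  exact ⟨{
    elt := fun i => w.getD i ⊤
    join := join
    meet := meet
    mid := mid
    elt_zero := by
      obtain ⟨l, rfl⟩ := hw.exists_eq_cons
      rfl
    elt_top := hlast
    wcovBy := hw.getD_wcovBy
    isLUB_join := hjoin
    isGLB_meet := hmeet
    isMeetAbove_mid := fun i y z hyz => (hmid i y z hyz).1
    isJoinBelow_mid := fun i y z hyz => (hmid i y z hyz).2 }⟩

end BoundedPoset

theorem mainTheorem3 {P : Type*} [PartialOrder P] [BoundedOrder P] [Finite P] (n : ℕ)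
    (hP : BoundedPoset.IsGradedOfRank P n) :
    List.TFAE [
      ∃ γ : P → P → ℤ, BoundedPoset.IsSnELLabelling n γ,
      BoundedPoset.IsLeftModular P,
      BoundedPoset.IsSupersolvable P] := by
  tfae_have 1 → 3 := fun ⟨_, hγ⟩ => (hγ.labelSystem hP).isSupersolvable
  tfae_have 3 → 2 := fun h => h.isLeftModular
  tfae_have 2 → 1 := fun h => by
    obtain ⟨X⟩ := h.nonempty_leftModularChain hP
    exact ⟨X.labelling, X.isSnELLabelling⟩
  tfae_finish
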